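/- Setting. An instance consists of $n\ge 1$ candidates; candidate $i$ has a value $\rho_i\ge 0$ for the receiver and a value $\xi_i\ge 0$ for the sender, where the $\rho_i$ are pairwise distinct and the $\xi_i$ are pairwise distinct. Both players know all pairs $(\rho_i,\xi_i)$. The candidates arrive in $n$ rounds in uniformly random order. A (direct) mechanism, to which the sender commits and which is known to the receiver, chooses in each round $t$, possibly at random, a signal HIRE or NOT, depending on the candidates that arrived in rounds $1,\dots,t$ and on the earlier signals. After each signal the receiver irrevocably hires the current candidate, which ends the process, or rejects it. In round $t$ she has seen the signals of rounds $1,\dots,t$ and, in the scenario with disclosure, also the identities of the candidates rejected in rounds $1,\dots,t-1$; without disclosure she sees only the signals. The receiver maximizes the expected $\rho$-value of the hired candidate ($0$ if nobody is hired). A mechanism is persuasive if in every round that an obedient receiver can reach with positive probability, conditional on everything she has observed, no deviating strategy for the current and later rounds gives her a strictly larger expected value than obedience (hire upon HIRE, reject upon NOT). The value of a persuasive mechanism for the sender is computed for the obedient receiver: for cardinal sender utility it is the expected $\xi$-value of the hired candidate, for ordinal sender utility the probability that the candidate with the largest $\xi$-value is hired. The benchmark optimum $\mathrm{OPT}$ of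 an instance is the largest value for the sender that a persuasive mechanism achieves in the scenario without disclosure. Theorem. For every $\varepsilon>0$ there is an instance such that, for cardinal as well as for ordinal sender utility, the benchmark optimum $\mathrm{OPT}$ exists and every mechanism that is persuasive in the scenario with disclosure has value at most $\left(\frac12+\varepsilon\right)\mathrm{OPT}$ for the sender. -/

import Mathlib

namespace Persuasion

/-- The valuation pairs of the candidates `0, …, n - 1`: candidate `i` has value `recv i` for the
receiver and `send i` for the sender.  Values are non-negative, and for each of the two players
the values of different candidates are different. -/
structure Instance (n : ℕ) where
  recv : Fin n → ℝ
  send : Fin n → ℝ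
  recv_nonneg : ∀ i, 0 ≤ recv i
  send_nonneg : ∀ i, 0 ≤ send i
  recv_injective : Function.Injective recv
  send_injective : Function.Injective send

/-- What the receiver learns about candidates that she rejected. -/
inductive Scenario
  | noDisclosure
  | disclosure

/-- The objective of the sender: the expected value of the hired candidate, or the probability
that the hired candidate is the sender-optimal one. -/
inductive Objective
  | cardinal
  | ordinal

/-- The sender's payoff when candidate `i` is hired. -/
noncomputable def Instance.senderPayoff {n : ℕ} (I : Instance n) : Objective → Fin n → ℝ
  | .cardinal, i => I.send i
  | .ordinal, i => open Classical in if ∀ j, I.send j ≤ I.send i then 1 else 0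

/-- An arrival order: `π t` is the candidate that arrives in round `t`. -/
abbrev Order (n : ℕ) := Equiv.Perm (Fin n)

/-- The signals of all rounds: `true` is HIRE and `false` is NOT. -/
abbrev Signals (n : ℕ) := Fin n → Bool

/-- A direct (randomized) signaling mechanism: the probability of the signal HIRE in round `t`,
given the candidates that arrived in rounds `0, …, t` and the signals of rounds `0, …, t - 1`.
(Rounds are numbered from `0`.  If round `t` is reached, then all earlier candidates were
rejected, so this is all that the sender can condition on.) -/
abbrev Mechanism (n : ℕ) :=
  (t : Fin n) → (Fin (t + 1) → Fin n) → (Fin t → Bool) → unitInterval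

/-- The probability of HIRE in round `t` when the candidates arrive in the order `π` and the
signals before round `t` are those of `σ`. -/
def Mechanism.hireProb {n : ℕ} (φ : Mechanism n) (π : Order n) (σ : Signals n) (t : Fin n) : ℝ :=
  φ t (fun s => π (Fin.castLE t.isLt s)) (fun s => σ (Fin.castLE t.isLt.le s))

/-- The joint probability of the arrival order `π` (uniform) and the signals `σ` that the
mechanism sends along it as long as nobody is hired. -/
noncomputable def Mechanism.prob {n : ℕ} (φ : Mechanism n) (π : Order n) (σ : Signals n) : ℝ :=
  (1 / (Nat.factorial n : ℝ)) *
    ∏ t, if σ t = true then φ.hireProb π σ t else 1 - φ.hireProb π σ t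

/-- Expectation over the random arrival order and the random signals. -/
noncomputable def Mechanism.expect {n : ℕ} (φ : Mechanism n) (f : Order n → Signals n → ℝ) : ℝ :=
  ∑ π : Order n, ∑ σ : Signals n, φ.prob π σ * f π σ

/-- The information about the candidates of rounds `0, …, t - 1` that is disclosed to the
receiver when she rejects them. -/
def Revealed : Scenario → ℕ → ℕ → Type
  | .noDisclosure, _, _ => Unit
  | .disclosure, n, t => Fin t → Fin n

/-- What the receiver has seen when she decides in round `t`: the signals of rounds `0, …, t`
and the disclosed information about the rejected candidates. -/
abbrev Observation (d : Scenario) (n : ℕ) (t : Fin n) :=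
  (Fin (t + 1) → Bool) × Revealed d n t

def revealed {n : ℕ} (d : Scenario) (π : Order n) (t : Fin n) : Revealed d n t :=
  match d with
  | .noDisclosure => ()
  | .disclosure => fun s => π (Fin.castLE t.isLt.le s)

def observe {n : ℕ} (d : Scenario) (π : Order n) (σ : Signals n) (t : Fin n) :
    Observation d n t :=
  (fun s => σ (Fin.castLE t.isLt s), revealed d π t)

/-- A strategy of the receiver: whether to hire in round `t`, given the observation.
(Randomized strategies are mixtures of these and cannot achieve more.) -/
abbrev Strategy (d : Scenario) (n : ℕ) := (t : Fin n) → Observation d n t → Bool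

/-- The obedient strategy: hire if and only if the current signal is HIRE. -/
def obedient (d : Scenario) (n : ℕ) : Strategy d n := fun t o => o.1 (Fin.last t)

/-- The value under `u` of the candidate that the strategy `τ` hires when round `start` is reached
and `τ` is followed from that round on; it is `0` if nobody is hired. -/
noncomputable def payoffFrom {n : ℕ} {d : Scenario} (start : ℕ) (τ : Strategy d n)
    (u : Fin n → ℝ) (π : Order n) (σ : Signals n) : ℝ :=
  ∑ t : Fin n,
    open Classical in
    if start ≤ (t : ℕ) ∧ τ t (observe d π σ t) = true ∧
        ∀ s : Fin n, start ≤ (s : ℕ) → s < t → τ s (observe d π σ s) = false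
    then u (π t) else 0

/-- A mechanism is persuasive if in every round the receiver, who wants to maximize the expected
value of the hired candidate, cannot gain by deviating from obedience in this round and/or later
ones.  The round and the observation `o` range over those that an obedient receiver can reach, so
all signals before the current one are NOT.  Both sides are multiplied by the probability of `o`;
if that is positive, the inequality compares the expectations conditional on `o`. -/
def Mechanism.IsPersuasive {n : ℕ} (φ : Mechanism n) (d : Scenario) (I : Instance n) : Prop :=
  ∀ (t : Fin n) (o : Observation d n t), (∀ s : Fin t, o.1 s.castSucc = false) →
    ∀ τ : Strategy d n,
      φ.expect (fun π σ => open Classical in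
          if observe d π σ t = o then payoffFrom t τ I.recv π σ else 0) ≤
        φ.expect (fun π σ => open Classical in
          if observe d π σ t = o then payoffFrom t (obedient d n) I.recv π σ else 0)

/-- The expected payoff of the sender when the receiver is obedient. -/
noncomputable def Mechanism.senderValue {n : ℕ} (φ : Mechanism n) (d : Scenario) (I : Instance n)
    (obj : Objective) : ℝ :=
  φ.expect (payoffFrom 0 (obedient d n) (I.senderPayoff obj))

/-- `v` is the optimum of the benchmark scenario: the largest value for the sender of a persuasive
mechanism in the basic scenario without disclosure. -/
def Instance.IsBenchmarkOptimum {n : ℕ} (I : Instance n) (obj : Objective) (v : ℝ) : Prop :=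
  IsGreatest {x : ℝ | ∃ φ : Mechanism n,
    φ.IsPersuasive .noDisclosure I ∧ x = φ.senderValue .noDisclosure I obj} v

end Persuasion

/-!
Without disclosure the receiver learns only in which round she is told to hire. If the mechanism
hires a candidate drawn from a fixed distribution `q`, independently of the arrival order, then any
other round offers her a uniformly random candidate among those not drawn, so obedience is optimal
as soon as the mean value under `q` is at least the uniform mean. Let candidate `A` be worth `2 n`
to her, candidate `B` nothing, and everybody else about `1`. The uniform mean is then at most `4`,
so it suffices to put weight `2 / n` on `A`, and the remaining weight can go to `B`, essentially the
only candidate that the sender values.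

With disclosure the receiver knows when `A` has been rejected. From then on every candidate is worth
at most about `1` to her, while hiring the very next one yields about `1` unless that one is `B`.
Hence a persuasive mechanism can afterwards lead her to `B` only with vanishing probability. So `B`
must essentially be hired before `A` arrives, and `B` precedes `A` with probability `1 / 2`.
-/

namespace Persuasion

open Finset
open scoped BigOperators

section RandomPermutation

variable {α K : Type*} [Fintype α] [DecidableEq α] [Field K] [CharZero K]

theorem expect_perm_apply (a : α) (f : α → K) : 𝔼 π : Equiv.Perm α, f (π a) = 𝔼 x, f x := by
  have : Nonempty α := ⟨a⟩
  have position_irrelevant (b : α) : 𝔼 π : Equiv.Perm α, f (π b) = 𝔼 π : Equiv.Perm α, f (π a) :=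
    Fintype.expect_equiv (Equiv.mulRight (Equiv.swap a b)) _ _ fun π => by simp
  calc 𝔼 π : Equiv.Perm α, f (π a)
      = 𝔼 b, 𝔼 π : Equiv.Perm α, f (π b) := by simp only [position_irrelevant, Fintype.expect_const]
    _ = 𝔼 π : Equiv.Perm α, 𝔼 b, f (π b) := expect_comm _ _ _
    _ = 𝔼 x, f x := by
      simp only [fun π : Equiv.Perm α => Fintype.expect_equiv π (fun b => f (π b)) f fun _ => rfl,
        Fintype.expect_const]

theorem expect_perm_apply_mul_apply {a b : α} (hab : a ≠ b) (f g : α → K) :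
    𝔼 π : Equiv.Perm α, f (π a) * g (π b) =
      ((∑ x, f x) * ∑ x, g x - ∑ x, f x * g x) / (Fintype.card α * (Fintype.card α - 1)) := by
  have position_irrelevant : ∀ c ∈ univ.erase a,
      𝔼 π : Equiv.Perm α, f (π a) * g (π c) = 𝔼 π : Equiv.Perm α, f (π a) * g (π b) := fun c hc =>
    Fintype.expect_equiv (Equiv.mulRight (Equiv.swap b c)) _ _ fun π => by
      simp [Equiv.swap_apply_of_ne_of_ne hab (ne_of_mem_erase hc).symm]
  have average_positions (π : Equiv.Perm α) : ∑ c ∈ univ.erase a, f (π a) * g (π c) =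
      f (π a) * ((∑ x, g x) - g (π a)) := by
    rw [← mul_sum, ← Equiv.sum_comp π g, sum_erase_eq_sub (mem_univ a)]
  have card_erase : (#(univ.erase a) : K) = Fintype.card α - 1 := by
    rw [card_erase_of_mem (mem_univ a), card_univ, Nat.cast_pred (Fintype.card_pos_iff.2 ⟨a⟩)]
  have card_sub_one_ne_zero : (Fintype.card α : K) - 1 ≠ 0 := by
    rw [← card_erase, Nat.cast_ne_zero]
    exact (card_pos.2 ⟨b, mem_erase.2 ⟨hab.symm, mem_univ b⟩⟩).ne'
  have total : (Fintype.card α - 1) * 𝔼 π : Equiv.Perm α, f (π a) * g (π b) =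
      ((∑ x, f x) * ∑ x, g x - ∑ x, f x * g x) / Fintype.card α := by
    rw [← card_erase, ← nsmul_eq_mul, ← sum_const, ← sum_congr rfl position_irrelevant,
      ← expect_sum_comm]
    simp only [average_positions]
    rw [expect_perm_apply a fun x => f x * ((∑ y, g y) - g x), Fintype.expect_eq_sum_div_card]
    simp only [mul_sub, sum_sub_distrib, sum_mul]
  rw [← div_div, ← total, mul_div_cancel_left₀ _ card_sub_one_ne_zero]

theorem expect_perm_symm_lt [LinearOrder α] {a b : α} (hab : a ≠ b) :
    𝔼 π : Equiv.Perm α, (if π.symm b < π.symm a then (1 : K) else 0) = 1 / 2 := by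
  have swap_roles : 𝔼 π : Equiv.Perm α, (if π.symm b < π.symm a then (1 : K) else 0) =
      𝔼 π : Equiv.Perm α, (if π.symm a < π.symm b then (1 : K) else 0) :=
    Fintype.expect_equiv (Equiv.mulLeft (Equiv.swap a b)) _ _ fun π => by
      simp [← Equiv.Perm.inv_def]
  have one_first (π : Equiv.Perm α) : (if π.symm b < π.symm a then (1 : K) else 0) +
      (if π.symm a < π.symm b then (1 : K) else 0) = 1 := by
    rcases lt_or_gt_of_ne (π.symm.injective.ne hab) with h | h <;> simp [h, h.not_gt]
  have total := expect_add_distrib univ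
    (fun π : Equiv.Perm α => if π.symm b < π.symm a then (1 : K) else 0)
    (fun π : Equiv.Perm α => if π.symm a < π.symm b then (1 : K) else 0)
  simp only [one_first, Fintype.expect_const, ← swap_roles] at total
  linear_combination -total / 2

end RandomPermutation

section Kernel

theorem sum_prod_kernel {R β : Type*} [CommSemiring R] [Fintype β] {n : ℕ}
    (κ : (t : Fin n) → (Fin t → β) → β → R) (hκ : ∀ t h, ∑ b, κ t h b = 1) :
    ∑ σ : Fin n → β, ∏ t : Fin n, κ t (fun s => σ (Fin.castLE t.isLt.le s)) (σ t) = 1 := by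
  induction n with
  | zero => simp
  | succ n ih =>
    have early_factor (σ : Fin n → β) (b : β) (t : Fin n) :
        κ t.castSucc (fun s => (Fin.snoc σ b : Fin (n + 1) → β) (Fin.castLE t.castSucc.isLt.le s)) =
          κ t.castSucc fun s : Fin t => σ (Fin.castLE t.isLt.le s) :=
      congrArg _ <| funext fun s => Fin.snoc_castSucc (α := fun _ => β) b σ (Fin.castLE t.isLt.le s)
    have last_factor (σ : Fin n → β) (b : β) :
        κ (Fin.last n) (fun s => (Fin.snoc σ b : Fin (n + 1) → β)
          (Fin.castLE (Fin.last n).isLt.le s)) = κ (Fin.last n) σ :=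
      congrArg _ <| funext fun s => Fin.snoc_castSucc (α := fun _ => β) b σ s
    rw [← (Fin.snocEquiv fun _ : Fin (n + 1) => β).sum_comp, Fintype.sum_prod_type_right,
      ← ih (fun t => κ t.castSucc) fun t => hκ t.castSucc]
    refine sum_congr rfl fun σ _ => ?_
    simp only [Fin.snocEquiv_apply, Fin.prod_univ_castSucc, early_factor, last_factor,
      Fin.snoc_castSucc (α := fun _ => β), Fin.snoc_last]
    rw [← mul_sum, hκ, mul_one]

end Kernel

section Expectation

variable {n : ℕ} (φ : Mechanism n)

theorem Mechanism.prob_nonneg (π : Order n) (σ : Signals n) : 0 ≤ φ.prob π σ := by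
  refine mul_nonneg (by positivity) (prod_nonneg fun t _ => ?_)
  split_ifs
  exacts [unitInterval.nonneg _, unitInterval.one_minus_nonneg _]

theorem Mechanism.sum_prob (π : Order n) : ∑ σ, φ.prob π σ = 1 / (Nat.factorial n : ℝ) := by
  simp only [Mechanism.prob, ← mul_sum]
  refine mul_right_eq_self₀.2 <| .inl <| sum_prod_kernel (fun t h (b : Bool) =>
    if b = true then (φ t (fun s => π (Fin.castLE t.isLt s)) h : ℝ)
    else 1 - φ t (fun s => π (Fin.castLE t.isLt s)) h) fun t h => ?_
  simp

theorem Mechanism.expect_mono {f g : Order n → Signals n → ℝ} (h : ∀ π σ, f π σ ≤ g π σ) :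
    φ.expect f ≤ φ.expect g :=
  sum_le_sum fun π _ => sum_le_sum fun σ _ => mul_le_mul_of_nonneg_left (h π σ) (φ.prob_nonneg π σ)

theorem Mechanism.expect_add (f g : Order n → Signals n → ℝ) :
    φ.expect (fun π σ => f π σ + g π σ) = φ.expect f + φ.expect g := by
  simp only [Mechanism.expect, mul_add, sum_add_distrib]

theorem Mechanism.expect_sum {ι : Type*} (s : Finset ι) (f : ι → Order n → Signals n → ℝ) :
    φ.expect (fun π σ => ∑ i ∈ s, f i π σ) = ∑ i ∈ s, φ.expect (f i) := by
  simp only [Mechanism.expect, mul_sum, sum_comm (s := s)]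

theorem Mechanism.expect_order (f : Order n → ℝ) : φ.expect (fun π _ => f π) = 𝔼 π, f π := by
  simp only [Mechanism.expect, ← sum_mul, φ.sum_prob, Fintype.expect_eq_sum_div_card,
    Fintype.card_perm, Fintype.card_fin, one_div_mul_eq_div, sum_div]

theorem Mechanism.continuous_expect (f : Order n → Signals n → ℝ) :
    Continuous fun φ : Mechanism n => φ.expect f := by
  have continuous_hireProb (π : Order n) (σ : Signals n) (t : Fin n) :
      Continuous fun φ : Mechanism n => φ.hireProb π σ t := by
    unfold Mechanism.hireProb
    fun_prop
  unfold Mechanism.expect Mechanism.prob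
  refine continuous_finsetSum _ fun π _ => continuous_finsetSum _ fun σ _ =>
    (continuous_const.mul (continuous_finsetProd _ fun t _ => ?_)).mul continuous_const
  split_ifs
  exacts [continuous_hireProb π σ t, continuous_const.sub (continuous_hireProb π σ t)]

end Expectation

section BenchmarkOptimum

variable {n : ℕ} (I : Instance n)

theorem Mechanism.isClosed_setOf_isPersuasive (d : Scenario) :
    IsClosed {φ : Mechanism n | φ.IsPersuasive d I} := by
  simp only [Mechanism.IsPersuasive, Set.ofPred_forall]
  exact isClosed_iInter fun t => isClosed_iInter fun o => isClosed_iInter fun _ =>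
    isClosed_iInter fun τ =>
      isClosed_le (Mechanism.continuous_expect _) (Mechanism.continuous_expect _)

theorem Instance.exists_isBenchmarkOptimum (obj : Objective)
    (hI : ∃ φ : Mechanism n, φ.IsPersuasive .noDisclosure I) :
    ∃ v, I.IsBenchmarkOptimum obj v := by
  obtain ⟨φ, hφ, hmax⟩ :=
    (Mechanism.isClosed_setOf_isPersuasive I .noDisclosure).isCompact.exists_isMaxOn hI
      (Mechanism.continuous_expect
        (payoffFrom 0 (obedient .noDisclosure n) (I.senderPayoff obj))).continuousOn
  refine ⟨_, ⟨φ, hφ, rfl⟩, ?_⟩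
  rintro x ⟨ψ, hψ, rfl⟩
  exact hmax hψ

end BenchmarkOptimum

section HireRound

variable {n : ℕ} {d : Scenario}

/-- Under the strategy `τ`, followed from round `start` on, the candidate of round `r` is hired. -/
def IsHireRound (start : ℕ) (τ : Strategy d n) (π : Order n) (σ : Signals n) (r : Fin n) : Prop :=
  start ≤ (r : ℕ) ∧ τ r (observe d π σ r) = true ∧
    ∀ s : Fin n, start ≤ (s : ℕ) → s < r → τ s (observe d π σ s) = false

theorem IsHireRound.unique {start : ℕ} {τ : Strategy d n} {π : Order n} {σ : Signals n}
    {r s : Fin n} (hr : IsHireRound start τ π σ r) (hs : IsHireRound start τ π σ s) : s = r := by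
  by_contra hne
  rcases lt_or_gt_of_ne hne with h | h
  · exact Bool.false_ne_true ((hr.2.2 s hs.1 h).symm.trans hs.2.1)
  · exact Bool.false_ne_true ((hs.2.2 r hr.1 h).symm.trans hr.2.1)

theorem IsHireRound.payoffFrom_eq {start : ℕ} {τ : Strategy d n} {π : Order n} {σ : Signals n}
    {r : Fin n} (hr : IsHireRound start τ π σ r) (u : Fin n → ℝ) :
    payoffFrom start τ u π σ = u (π r) :=
  (sum_eq_single_of_mem r (mem_univ r) fun _ _ hne => if_neg fun h => hne (hr.unique h)).trans
    (if_pos hr)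

theorem payoffFrom_eq_zero {start : ℕ} {τ : Strategy d n} {π : Order n} {σ : Signals n}
    (h : ¬ ∃ r, IsHireRound start τ π σ r) (u : Fin n → ℝ) : payoffFrom start τ u π σ = 0 :=
  sum_eq_zero fun r _ => if_neg fun hr => h ⟨r, hr⟩

theorem payoffFrom_nonneg {u : Fin n → ℝ} (hu : 0 ≤ u) (start : ℕ) (τ : Strategy d n)
    (π : Order n) (σ : Signals n) : 0 ≤ payoffFrom start τ u π σ := by
  refine sum_nonneg fun t _ => ?_
  split_ifs
  exacts [hu _, le_rfl]

theorem payoffFrom_le_payoffFrom_add {u v : Fin n → ℝ} {c : ℝ} (hc : 0 ≤ c)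
    (huv : ∀ i, u i ≤ v i + c) (start : ℕ) (τ : Strategy d n) (π : Order n) (σ : Signals n) :
    payoffFrom start τ u π σ ≤ payoffFrom start τ v π σ + c := by
  by_cases hire : ∃ r, IsHireRound start τ π σ r
  · obtain ⟨r, hr⟩ := hire
    simpa only [hr.payoffFrom_eq] using huv (π r)
  · simpa only [payoffFrom_eq_zero hire, zero_add] using hc

theorem payoffFrom_obedient_of_not {π : Order n} {σ : Signals n} {t : Fin n}
    (hσ : ∀ s < t, σ s = false) (u : Fin n → ℝ) :
    payoffFrom t (obedient d n) u π σ = payoffFrom 0 (obedient d n) u π σ := by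
  refine sum_congr rfl fun r _ => if_congr ?_ rfl rfl
  change (_ ∧ σ r = true ∧ ∀ s : Fin n, _ → _ → σ s = false) ↔
    _ ∧ σ r = true ∧ ∀ s : Fin n, _ → _ → σ s = false
  grind

end HireRound

section NoDisclosure

variable {n : ℕ} {φ : Mechanism n} {I : Instance n}

theorem Mechanism.isPersuasive_noDisclosure_of_forall_signals
    (h : ∀ σ t, ∑ π, φ.prob π σ * I.recv (π t) ≤
      ∑ π, φ.prob π σ * payoffFrom 0 (obedient .noDisclosure n) I.recv π σ) :
    φ.IsPersuasive .noDisclosure I := by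
  intro t o ho τ
  simp only [Mechanism.expect]
  rw [sum_comm, sum_comm (γ := Order n)]
  refine sum_le_sum fun σ _ => ?_
  by_cases hσ : observe .noDisclosure 1 σ t = o
  · have observed (π : Order n) : observe .noDisclosure π σ t = o := hσ
    have all_not (s : Fin n) (hs : s < t) : σ s = false := by
      subst hσ
      exact ho ⟨s, hs⟩
    simp only [observed, if_true, payoffFrom_obedient_of_not all_not]
    by_cases hire : ∃ r, IsHireRound t τ 1 σ r
    · obtain ⟨r, hr⟩ := hire
      have hire_r (π : Order n) : IsHireRound t τ π σ r := hr
      simpa only [(hire_r _).payoffFrom_eq] using h σ r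
    · have hire_none (π : Order n) : payoffFrom t τ I.recv π σ = 0 :=
        payoffFrom_eq_zero (π := π) hire _
      simpa only [hire_none, mul_zero, sum_const_zero] using sum_nonneg fun π _ =>
        mul_nonneg (φ.prob_nonneg π σ) (payoffFrom_nonneg I.recv_nonneg _ _ π σ)
  · have not_observed (π : Order n) : observe .noDisclosure π σ t ≠ o := hσ
    simp only [not_observed, if_false, mul_zero, sum_const_zero, le_refl]

end NoDisclosure

section Lottery

section Hazard

variable {ι K : Type*} [Fintype ι] [LinearOrder ι] [Field K] [LinearOrder K]
  [IsStrictOrderedRing K] {w : ι → K} (hw : ∀ i, 0 ≤ w i)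
include hw

theorem div_sum_le_mul_sum_le (r : ι) :
    w r / (∑ i with r ≤ i, w i) * ∑ i with r ≤ i, w i = w r :=
  div_mul_cancel_of_imp fun hzero =>
    (sum_eq_zero_iff_of_nonneg fun i _ => hw i).1 hzero r (by simp)

theorem prod_one_sub_div_sum_le (hw_sum : ∑ i, w i = 1) (r : ι) :
    ∏ s with s < r, (1 - w s / ∑ i with s ≤ i, w i) = ∑ i with r ≤ i, w i := by
  induction r using WellFoundedLT.induction with
  | ind r ih =>
    have total : ∑ s with s < r, w s + ∑ i with r ≤ i, w i = 1 := by
      simpa only [not_lt, hw_sum] using sum_filter_add_sum_filter_not univ (· < r) w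
    rw [prod_one_sub_ordered]
    refine sub_eq_of_eq_add' <| total.symm.trans <| congrArg (· + _) <| sum_congr rfl fun s hs => ?_
    have hsr : s < r := (mem_filter.1 hs).2
    have earlier : ({j | j < r} : Finset ι).filter (· < s) = ({j | j < s} : Finset ι) := by
      rw [filter_filter]
      exact filter_congr fun j _ => and_iff_right_of_imp fun h => lt_trans h hsr
    rw [earlier, ih s hsr, div_sum_le_mul_sum_le hw]

end Hazard

variable {n : ℕ}

/-- The signals NOT, …, NOT, HIRE, NOT, …, NOT that make an obedient receiver hire in round `r`. -/
def hireAt (r : Fin n) : Signals n := fun t => decide (t = r)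

theorem hireAt_injective : Function.Injective (hireAt : Fin n → Signals n) := fun r s h => by
  simpa [hireAt] using congrFun h r

theorem isHireRound_obedient_hireAt (d : Scenario) (π : Order n) (r : Fin n) :
    IsHireRound 0 (obedient d n) π (hireAt r) r :=
  ⟨r.val.zero_le, decide_eq_true rfl, fun _ _ hs => decide_eq_false hs.ne⟩

open Classical in
/-- The mechanism that hires candidate `i` with probability `q i`, independently of the arrival
order. In round `t` it signals HIRE with the hazard rate of the current candidate, i.e. the
probability that she was drawn from `q`, given that none of the earlier candidates was.
(The projection onto `[0, 1]` only matters for lists of arrivals with repetitions.) -/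
noncomputable def lotteryMechanism (q : Fin n → ℝ) : Mechanism n := fun t x h =>
  if ∀ s, h s = false then
    Set.projIcc 0 1 zero_le_one
      (q (x (Fin.last t)) / ∑ i with ∀ s : Fin t, x s.castSucc ≠ i, q i)
  else 0

variable {q : Fin n → ℝ} (hq : q ∈ stdSimplex ℝ (Fin n))
include hq

theorem lotteryMechanism_hireProb_of_not {σ : Signals n} {t : Fin n} (hσ : ∀ s < t, σ s = false)
    (π : Order n) :
    (lotteryMechanism q).hireProb π σ t = q (π t) / ∑ r with t ≤ r, q (π r) := by
  have all_not (s : Fin t) : σ (Fin.castLE t.isLt.le s) = false := hσ _ s.isLt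
  have remaining : ∑ i with ∀ s : Fin t, π (Fin.castLE t.isLt s.castSucc) ≠ i, q i =
      ∑ r with t ≤ r, q (π r) := by
    simp only [sum_filter]
    rw [← Equiv.sum_comp π]
    refine sum_congr rfl fun r _ => if_congr ?_ rfl rfl
    simp only [ne_eq, π.injective.eq_iff]
    refine ⟨fun h => not_lt.1 fun hr => h ⟨r, hr⟩ rfl, fun h s hs => ?_⟩
    exact h.not_gt (hs ▸ s.isLt)
  have hazard_le_one : q (π t) / ∑ r with t ≤ r, q (π r) ≤ 1 :=
    div_le_one_of_le₀ (single_le_sum (f := fun r => q (π r)) (fun _ _ => hq.1 _) (by simp))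
      (sum_nonneg fun _ _ => hq.1 _)
  have hazard_nonneg : 0 ≤ q (π t) / ∑ r with t ≤ r, q (π r) :=
    div_nonneg (hq.1 _) (sum_nonneg fun _ _ => hq.1 _)
  rw [Mechanism.hireProb, lotteryMechanism, if_pos all_not, remaining]
  exact congrArg Subtype.val (Set.projIcc_of_mem zero_le_one ⟨hazard_nonneg, hazard_le_one⟩)

theorem lotteryMechanism_prob_hireAt (π : Order n) (r : Fin n) :
    (lotteryMechanism q).prob π (hireAt r) = 1 / (Nat.factorial n : ℝ) * q (π r) := by
  have hazard_before {t : Fin n} (ht : t ≤ r) : (lotteryMechanism q).hireProb π (hireAt r) t =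
      q (π t) / ∑ s with t ≤ s, q (π s) :=
    lotteryMechanism_hireProb_of_not hq (fun s hs => decide_eq_false (hs.trans_le ht).ne) π
  have not_after {t : Fin n} (ht : r < t) : (lotteryMechanism q).hireProb π (hireAt r) t = 0 := by
    have signaled : ¬ ∀ s : Fin t, hireAt r (Fin.castLE t.isLt.le s) = false := fun h =>
      Bool.false_ne_true ((h ⟨r, ht⟩).symm.trans (decide_eq_true rfl))
    rw [Mechanism.hireProb, lotteryMechanism, if_neg signaled, Set.Icc.coe_zero]
  have factor (t : Fin n) : (if hireAt r t = true then (lotteryMechanism q).hireProb π (hireAt r) t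
      else 1 - (lotteryMechanism q).hireProb π (hireAt r) t) =
      (if t = r then q (π t) / ∑ s with t ≤ s, q (π s) else 1) *
        if t < r then 1 - q (π t) / ∑ s with t ≤ s, q (π s) else 1 := by
    rcases lt_trichotomy t r with h | rfl | h
    · simp [hireAt, h, h.ne, hazard_before h.le]
    · simp [hireAt, hazard_before le_rfl]
    · simp [hireAt, h.ne', h.not_gt, not_after h]
  have weights_sum : ∑ r, q (π r) = 1 := (Equiv.sum_comp π q).trans hq.2
  rw [Mechanism.prob, prod_congr rfl fun t _ => factor t, prod_mul_distrib, ← prod_filter (· < r),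
    prod_one_sub_div_sum_le (fun _ => hq.1 _) weights_sum]
  simp only [prod_ite_eq', mem_univ, if_true, div_sum_le_mul_sum_le fun s => hq.1 (π s)]

theorem lotteryMechanism_prob_eq_zero (π : Order n) {σ : Signals n}
    (hσ : σ ∉ Set.range hireAt) : (lotteryMechanism q).prob π σ = 0 := by
  have hireAt_total : ∑ σ ∈ univ.image hireAt, (lotteryMechanism q).prob π σ =
      ∑ σ, (lotteryMechanism q).prob π σ := by
    rw [sum_image hireAt_injective.injOn, Mechanism.sum_prob]
    simp only [lotteryMechanism_prob_hireAt hq, ← mul_sum, Equiv.sum_comp π q, hq.2, mul_one]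
  rw [← sum_add_sum_compl (univ.image hireAt), left_eq_add] at hireAt_total
  exact (sum_eq_zero_iff_of_nonneg fun σ _ => Mechanism.prob_nonneg _ π σ).1 hireAt_total σ
    (by simpa using hσ)

theorem lotteryMechanism_expect (f : Order n → Signals n → ℝ) :
    (lotteryMechanism q).expect f = 𝔼 π, ∑ r, q (π r) * f π (hireAt r) := by
  have signals_sum (π : Order n) : ∑ σ, (lotteryMechanism q).prob π σ * f π σ =
      (∑ r, q (π r) * f π (hireAt r)) / Nat.factorial n := by
    rw [← Fintype.sum_of_injective hireAt hireAt_injective _ _ (fun σ hσ => by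
      rw [lotteryMechanism_prob_eq_zero hq π hσ, zero_mul]) fun r => rfl]
    simp only [lotteryMechanism_prob_hireAt hq, div_mul_eq_mul_div, one_mul, sum_div]
  simp only [Mechanism.expect, signals_sum, ← sum_div, Fintype.expect_eq_sum_div_card,
    Fintype.card_perm, Fintype.card_fin]

theorem lotteryMechanism_senderValue (d : Scenario) (I : Instance n) (obj : Objective) :
    (lotteryMechanism q).senderValue d I obj = ∑ i, q i * I.senderPayoff obj i := by
  simp only [Mechanism.senderValue, lotteryMechanism_expect hq,
    (isHireRound_obedient_hireAt d _ _).payoffFrom_eq,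
    Equiv.sum_comp _ fun i => q i * I.senderPayoff obj i, Fintype.expect_const]

theorem lotteryMechanism_isPersuasive {I : Instance n}
    (hI : 𝔼 i, I.recv i ≤ ∑ i, q i * I.recv i) :
    (lotteryMechanism q).IsPersuasive .noDisclosure I := by
  have expected_le (r t : Fin n) :
      𝔼 π : Order n, q (π r) * I.recv (π t) ≤ 𝔼 π : Order n, q (π r) * I.recv (π r) := by
    rcases eq_or_ne r t with rfl | hrt
    · exact le_rfl
    have one_lt_n : (1 : ℝ) < n := by
      exact_mod_cast Fintype.card_fin n ▸ Fintype.one_lt_card_iff.2 ⟨r, t, hrt⟩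
    rw [expect_perm_apply_mul_apply hrt, expect_perm_apply r fun i => q i * I.recv i,
      Fintype.expect_eq_sum_div_card, Fintype.card_fin, hq.2, one_mul]
    rw [Fintype.expect_eq_sum_div_card, Fintype.card_fin, div_le_iff₀ (by linarith)] at hI
    rw [← div_div, div_right_comm]
    refine div_le_div_of_nonneg_right ?_ (by linarith)
    rw [div_le_iff₀ (by linarith)]
    linarith
  refine Mechanism.isPersuasive_noDisclosure_of_forall_signals fun σ t => ?_
  by_cases hσ : σ ∈ Set.range hireAt
  · obtain ⟨r, rfl⟩ := hσ
    simp only [lotteryMechanism_prob_hireAt hq, (isHireRound_obedient_hireAt _ _ _).payoffFrom_eq,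
      mul_assoc, ← mul_sum]
    refine mul_le_mul_of_nonneg_left ?_ (by positivity)
    have := expected_le r t
    rwa [Fintype.expect_eq_sum_div_card, Fintype.expect_eq_sum_div_card,
      div_le_div_iff_of_pos_right (by positivity)] at this
  · simp only [lotteryMechanism_prob_eq_zero hq _ hσ, zero_mul, le_refl]

end Lottery

section Disclosure

variable {n : ℕ} {φ : Mechanism n} {I : Instance n}

theorem Mechanism.IsPersuasive.expect_ite_payoffFrom_le {d : Scenario} (hφ : φ.IsPersuasive d I)
    {t : Fin n} {P : Observation d n t → Prop} [DecidablePred P]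
    (hP : ∀ o, P o → ∀ s : Fin t, o.1 s.castSucc = false) (τ : Strategy d n) :
    φ.expect (fun π σ => if P (observe d π σ t) then payoffFrom t τ I.recv π σ else 0) ≤
      φ.expect fun π σ =>
        if P (observe d π σ t) then payoffFrom t (obedient d n) I.recv π σ else 0 := by
  classical
  let O : Finset (Observation d n t) :=
    {o ∈ univ.image fun p : Order n × Signals n => observe d p.1 p.2 t | P o}
  have total_probability (f : Order n → Signals n → ℝ) :
      φ.expect (fun π σ => if P (observe d π σ t) then f π σ else 0) =
        ∑ o ∈ O, φ.expect fun π σ => if observe d π σ t = o then f π σ else 0 := by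
    rw [← φ.expect_sum]
    refine congrArg φ.expect (funext₂ fun π σ => ?_)
    rw [sum_ite_eq]
    refine if_congr ?_ rfl rfl
    simp only [O, mem_filter, iff_and_self]
    exact fun _ => mem_image_of_mem _ (mem_univ (π, σ))
  rw [total_probability, total_probability]
  exact sum_le_sum fun o ho => hφ t o (hP o (mem_filter.1 ho).2) τ

theorem Mechanism.IsPersuasive.expect_recv_le_of_disclosure (hφ : φ.IsPersuasive .disclosure I)
    {s t : Fin n} (hst : s < t) (i : Fin n) :
    φ.expect (fun π σ => if π s = i ∧ ∀ r < t, σ r = false then I.recv (π t) else 0) ≤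
      φ.expect fun π σ => if π s = i ∧ ∀ r < t, σ r = false then
        payoffFrom 0 (obedient .disclosure n) I.recv π σ else 0 := by
  let P (o : Observation .disclosure n t) : Prop :=
    (o.2 : Fin t → Fin n) ⟨s, hst⟩ = i ∧ ∀ r : Fin t, o.1 r.castSucc = false
  have event_iff (π : Order n) (σ : Signals n) :
      P (observe .disclosure π σ t) ↔ π s = i ∧ ∀ r < t, σ r = false :=
    and_congr_right' ⟨fun h r hr => h ⟨r, hr⟩, fun h r => h _ r.isLt⟩
  have : DecidablePred P := fun o => inferInstanceAs (Decidable (_ ∧ _))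
  have hire_now (π : Order n) (σ : Signals n) :
      payoffFrom t (fun _ _ => true : Strategy .disclosure n) I.recv π σ = I.recv (π t) :=
    IsHireRound.payoffFrom_eq ⟨le_rfl, rfl, fun r htr hrt => absurd hrt htr.not_gt⟩ _
  convert hφ.expect_ite_payoffFrom_le (P := P) (fun o ho => ho.2) (fun _ _ => true) using 4 with
    π σ π σ
  · rw [hire_now]
    exact if_congr (event_iff π σ).symm rfl rfl
  · refine (if_ctx_congr (event_iff π σ) (fun h => ?_) fun _ => rfl).symm
    exact payoffFrom_obedient_of_not h.2 _

variable {A B : Fin n}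

theorem payoffFrom_single_add_payoffFrom_le {d : Scenario} {u : Fin n → ℝ} {c : ℝ} (hc : 1 ≤ c)
    (hB : u B = 0) (h_le : ∀ i ≠ A, u i ≤ c) {π : Order n} {σ : Signals n} {s t : Fin n}
    (hst : s < t) (hA : π s = A) (hσ : ∀ r < t, σ r = false) :
    payoffFrom 0 (obedient d n) (Pi.single B 1) π σ + payoffFrom 0 (obedient d n) u π σ ≤ c := by
  by_cases hire : ∃ r, IsHireRound 0 (obedient d n) π σ r
  · obtain ⟨r, hr⟩ := hire
    have htr : t ≤ r := not_lt.1 fun h => Bool.false_ne_true ((hσ r h).symm.trans hr.2.1)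
    have hrA : π r ≠ A := hA ▸ π.injective.ne (hst.trans_le htr).ne'
    rw [hr.payoffFrom_eq, hr.payoffFrom_eq]
    rcases eq_or_ne (π r) B with hrB | hrB
    · simpa [hrB, hB] using hc
    · simpa [hrB] using h_le _ hrA
  · rw [payoffFrom_eq_zero hire, payoffFrom_eq_zero hire]
    linarith

theorem payoffFrom_single_le_ite_add_sum {m : ℕ} {d : Scenario} {A B : Fin (m + 1)} (hAB : A ≠ B)
    (π : Order (m + 1)) (σ : Signals (m + 1)) :
    payoffFrom 0 (obedient d (m + 1)) (Pi.single B 1) π σ ≤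
      (if π.symm B < π.symm A then 1 else 0) +
        ∑ s : Fin m, if π s.castSucc = A ∧ ∀ r < s.succ, σ r = false then
          payoffFrom 0 (obedient d (m + 1)) (Pi.single B 1) π σ else 0 := by
  have hired_nonneg : 0 ≤ payoffFrom 0 (obedient d (m + 1)) (Pi.single B 1) π σ :=
    payoffFrom_nonneg (Pi.single_nonneg.2 zero_le_one) _ _ π σ
  have summand_nonneg (s : Fin m) : 0 ≤ if π s.castSucc = A ∧ ∀ r < s.succ, σ r = false then
      payoffFrom 0 (obedient d (m + 1)) (Pi.single B 1) π σ else 0 := by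
    split_ifs
    exacts [hired_nonneg, le_rfl]
  have sum_nonneg := sum_nonneg fun s (_ : s ∈ univ) => summand_nonneg s
  have ite_nonneg : (0 : ℝ) ≤ if π.symm B < π.symm A then 1 else 0 := by split_ifs <;> norm_num
  by_cases hire : ∃ r, IsHireRound 0 (obedient d (m + 1)) π σ r
  · obtain ⟨r, hr⟩ := hire
    rcases eq_or_ne (π r) B with rfl | hrB
    · rw [π.symm_apply_apply] at ite_nonneg ⊢
      rcases lt_or_gt_of_ne (π.symm_apply_eq.not.2 hAB) with after | before
      · obtain ⟨s, hs⟩ := Fin.exists_castSucc_eq.2 (after.trans_le r.le_last).ne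
        have not_before_succ (q : Fin (m + 1)) (hq : q < s.succ) : σ q = false :=
          hr.2.2 q q.val.zero_le ((Fin.le_castSucc_iff.2 hq).trans_lt (hs ▸ after))
        have hired := single_le_sum (fun s _ => summand_nonneg s) (mem_univ s)
        rw [if_pos ⟨(π.symm_apply_eq.1 hs.symm).symm, not_before_succ⟩] at hired
        exact le_add_of_nonneg_of_le ite_nonneg hired
      · have hired_eq_one :=
          (hr.payoffFrom_eq _).trans (Pi.single_eq_same (M := fun _ => ℝ) (π r) 1)
        rw [if_pos before]
        exact le_add_of_le_of_nonneg hired_eq_one.le sum_nonneg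
    · have hired_eq_zero := (hr.payoffFrom_eq _).trans (Pi.single_eq_of_ne (M := fun _ => ℝ) hrB 1)
      exact hired_eq_zero.le.trans (add_nonneg ite_nonneg sum_nonneg)
  · exact (payoffFrom_eq_zero hire _).le.trans (add_nonneg ite_nonneg sum_nonneg)

variable {δ : ℝ}

theorem Mechanism.IsPersuasive.expect_hired_after_le (hφ : φ.IsPersuasive .disclosure I)
    (hAB : A ≠ B) (hδ : 0 ≤ δ) (hB : I.recv B = 0) (h_ge : ∀ i ≠ B, 1 ≤ I.recv i)
    (h_le : ∀ i ≠ A, I.recv i ≤ 1 + δ) {s t : Fin n} (hst : s < t) :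
    φ.expect (fun π σ => if π s = A ∧ ∀ r < t, σ r = false then
        payoffFrom 0 (obedient .disclosure n) (Pi.single B 1) π σ else 0) ≤
      δ / n + 1 / (n * (n - 1)) := by
  let a : Fin n → ℝ := Pi.single A 1
  let b : Fin n → ℝ := Pi.single B 1
  have a_nonneg : 0 ≤ a := Pi.single_nonneg.2 zero_le_one
  have b_nonneg : 0 ≤ b := Pi.single_nonneg.2 zero_le_one
  have current_ge (i : Fin n) : 1 ≤ I.recv i + b i := by
    rcases eq_or_ne i B with rfl | hi
    · simp [b, hB]
    · simpa [b, hi] using h_ge i hi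
  have pointwise (π : Order n) (σ : Signals n) :
      (if π s = A ∧ ∀ r < t, σ r = false then
          payoffFrom 0 (obedient .disclosure n) b π σ else 0) +
        (if π s = A ∧ ∀ r < t, σ r = false then
          payoffFrom 0 (obedient .disclosure n) I.recv π σ else 0) ≤
      (if π s = A ∧ ∀ r < t, σ r = false then I.recv (π t) else 0) +
        (δ * a (π s) + a (π s) * b (π t)) := by
    split_ifs with h
    · have a_eq_one : a (π s) = 1 := h.1 ▸ Pi.single_eq_same (M := fun _ => ℝ) A 1
      rw [a_eq_one, mul_one, one_mul]
      have hired_le := payoffFrom_single_add_payoffFrom_le (d := .disclosure) (c := 1 + δ)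
        (by linarith) hB h_le hst h.1 h.2
      linarith [current_ge (π t)]
    · simpa only [add_zero, zero_add] using
        add_nonneg (mul_nonneg hδ (a_nonneg _)) (mul_nonneg (a_nonneg _) (b_nonneg _))
  have expect_error : 𝔼 π : Order n, (δ * a (π s) + a (π s) * b (π t)) =
      δ / n + 1 / (n * (n - 1)) := by
    rw [expect_add_distrib, ← mul_expect, expect_perm_apply, expect_perm_apply_mul_apply hst.ne,
      Fintype.expect_eq_sum_div_card]
    simp [a, b, Pi.single_apply, hAB.symm, div_eq_mul_inv]
  have expected := φ.expect_mono pointwise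
  rw [φ.expect_add, φ.expect_add, φ.expect_order fun π => δ * a (π s) + a (π s) * b (π t),
    expect_error] at expected
  have := hφ.expect_recv_le_of_disclosure hst A
  change φ.expect (fun π σ => if π s = A ∧ ∀ r < t, σ r = false then
    payoffFrom 0 (obedient .disclosure n) b π σ else 0) ≤ _
  linarith

theorem Mechanism.IsPersuasive.expect_hired_le (hφ : φ.IsPersuasive .disclosure I)
    (hAB : A ≠ B) (hδ : 0 ≤ δ) (hB : I.recv B = 0) (h_ge : ∀ i ≠ B, 1 ≤ I.recv i)
    (h_le : ∀ i ≠ A, I.recv i ≤ 1 + δ) :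
    φ.expect (payoffFrom 0 (obedient .disclosure n) (Pi.single B 1)) ≤ 1 / 2 + 1 / n + δ := by
  obtain ⟨m, rfl⟩ : ∃ m, n = m + 1 := ⟨n - 1, (Nat.sub_add_cancel A.pos).symm⟩
  have hm : (m : ℝ) ≠ 0 := by
    have := Fin.val_ne_of_ne hAB
    exact_mod_cast (by omega : m ≠ 0)
  calc φ.expect (payoffFrom 0 (obedient .disclosure (m + 1)) (Pi.single B 1))
      ≤ 1 / 2 + ∑ _s : Fin m, (δ / (m + 1 : ℕ) + 1 / ((m + 1 : ℕ) * ((m + 1 : ℕ) - 1))) := by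
        refine (φ.expect_mono (payoffFrom_single_le_ite_add_sum hAB)).trans ?_
        rw [φ.expect_add, φ.expect_sum, φ.expect_order fun π =>
          if π.symm B < π.symm A then (1 : ℝ) else 0, expect_perm_symm_lt hAB]
        gcongr with s
        exact hφ.expect_hired_after_le hAB hδ hB h_ge h_le s.castSucc_lt_succ
    _ = 1 / 2 + 1 / (m + 1 : ℕ) + δ * (m / (m + 1 : ℕ)) := by
        simp only [sum_const, card_univ, Fintype.card_fin, nsmul_eq_mul, Nat.cast_add, Nat.cast_one,
          add_sub_cancel_right]
        field_simp
        ring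
    _ ≤ 1 / 2 + 1 / (m + 1 : ℕ) + δ := by
        gcongr
        refine mul_le_of_le_one_right hδ (div_le_one_of_le₀ ?_ (Nat.cast_nonneg _))
        exact_mod_cast m.le_succ

end Disclosure

section GapInstance

/-- Distinct perturbations between `0` and `1 / n`, which make the values of the candidates of
`gapInstance` pairwise distinct. -/
noncomputable def perturbation {n : ℕ} (i : Fin n) : ℝ := i / (n : ℝ) ^ 2

variable {n : ℕ} {A B : Fin n}

theorem perturbation_nonneg (i : Fin n) : 0 ≤ perturbation i := by
  unfold perturbation
  positivity

theorem perturbation_lt_one_div (i : Fin n) : perturbation i < 1 / n := by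
  have n_pos : (0 : ℝ) < n := by exact_mod_cast i.pos
  have i_lt_n : (i : ℝ) < n := by exact_mod_cast i.isLt
  rw [perturbation, div_lt_div_iff₀ (by positivity) n_pos]
  nlinarith

theorem perturbation_lt_one (i : Fin n) : perturbation i < 1 :=
  (perturbation_lt_one_div i).trans_le (one_div (n : ℝ) ▸ Nat.cast_inv_le_one n)

theorem perturbation_injective : Function.Injective (perturbation : Fin n → ℝ) := fun i j h => by
  have n_ne_zero : (n : ℝ) ≠ 0 := by exact_mod_cast i.pos.ne'
  exact Fin.ext (by exact_mod_cast (div_left_inj' (pow_ne_zero 2 n_ne_zero)).1 h)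

/-- Candidate `A` is by far the best one for the receiver, and candidate `B` is the best one for
the sender and worthless for the receiver. All other candidates are worth about `1` for the
receiver and about `0` for the sender. -/
noncomputable def gapInstance (A B : Fin n) : Instance n where
  recv i := if i = B then 0 else if i = A then 2 * n else 1 + perturbation i
  send i := if i = B then 1 else perturbation i
  recv_nonneg i := by
    have := perturbation_nonneg i
    split_ifs <;> positivity
  send_nonneg i := by
    have := perturbation_nonneg i
    split_ifs <;> positivity
  recv_injective i j h := by
    have n_ge_one : (1 : ℝ) ≤ n := by exact_mod_cast i.pos
    have := @perturbation_injective n i j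
    grind [perturbation_nonneg, perturbation_lt_one]
  send_injective i j h := by
    have := @perturbation_injective n i j
    grind [perturbation_lt_one]

theorem gapInstance_recv_right (A B : Fin n) : (gapInstance A B).recv B = 0 := if_pos rfl

theorem gapInstance_recv_left (hAB : A ≠ B) : (gapInstance A B).recv A = 2 * n := by
  simp [gapInstance, hAB]

theorem one_le_gapInstance_recv {i : Fin n} (hi : i ≠ B) : 1 ≤ (gapInstance A B).recv i := by
  have n_ge_one : (1 : ℝ) ≤ n := by exact_mod_cast i.pos
  simp only [gapInstance, if_neg hi]
  split_ifs <;> linarith [perturbation_nonneg i]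

theorem gapInstance_recv_le {i : Fin n} (hi : i ≠ A) : (gapInstance A B).recv i ≤ 1 + 1 / n := by
  have : 0 ≤ 1 / (n : ℝ) := by positivity
  simp only [gapInstance, if_neg hi]
  split_ifs <;> linarith [perturbation_lt_one_div i]

theorem gapInstance_senderPayoff_right (A B : Fin n) (obj : Objective) :
    (gapInstance A B).senderPayoff obj B = 1 := by
  cases obj with
  | cardinal => exact if_pos rfl
  | ordinal =>
    refine if_pos fun j => ?_
    simp only [gapInstance, if_true]
    split_ifs <;> linarith [perturbation_lt_one j]

theorem gapInstance_senderPayoff_nonneg (A B : Fin n) (obj : Objective) (i : Fin n) :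
    0 ≤ (gapInstance A B).senderPayoff obj i := by
  cases obj with
  | cardinal => exact (gapInstance A B).send_nonneg i
  | ordinal =>
    simp only [Instance.senderPayoff]
    split_ifs <;> norm_num

theorem gapInstance_senderPayoff_le (A B : Fin n) (obj : Objective) (i : Fin n) :
    (gapInstance A B).senderPayoff obj i ≤ (Pi.single B 1 : Fin n → ℝ) i + 1 / n := by
  have one_div_nonneg : (0 : ℝ) ≤ 1 / n := by positivity
  rcases eq_or_ne i B with rfl | hi
  · simp [gapInstance_senderPayoff_right]
  rw [Pi.single_eq_of_ne hi, zero_add]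
  cases obj with
  | cardinal => exact (if_neg hi).trans_le (perturbation_lt_one_div i).le
  | ordinal =>
    have not_optimal : ¬ ∀ j, (gapInstance A B).send j ≤ (gapInstance A B).send i := fun h => by
      have := h B
      simp only [gapInstance, if_true, if_neg hi] at this
      linarith [perturbation_lt_one i]
    exact (if_neg not_optimal).trans_le one_div_nonneg

/-- Hire `A` with probability `2 / n` and `B` otherwise: on `gapInstance A B` the receiver values
this at least as much as a uniformly random candidate, although `B` is almost certain. -/
noncomputable def gapLottery (A B : Fin n) : Fin n → ℝ :=
  (2 / n : ℝ) • Pi.single A 1 + (1 - 2 / n : ℝ) • Pi.single B 1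

theorem gapLottery_mem_stdSimplex (A B : Fin n) (hn : 2 ≤ n) :
    gapLottery A B ∈ stdSimplex ℝ (Fin n) := by
  have two_div_le_one : (2 / n : ℝ) ≤ 1 :=
    div_le_one_of_le₀ (by exact_mod_cast hn) n.cast_nonneg
  exact convex_stdSimplex ℝ (Fin n) (single_mem_stdSimplex ℝ A) (single_mem_stdSimplex ℝ B)
    (by positivity) (sub_nonneg.2 two_div_le_one) (add_sub_cancel _ _)

theorem sum_gapLottery_mul (A B : Fin n) (f : Fin n → ℝ) :
    ∑ i, gapLottery A B i * f i = 2 / n * f A + (1 - 2 / n) * f B := by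
  simp [gapLottery, add_mul, sum_add_distrib, Pi.single_apply]

theorem lotteryMechanism_gapLottery_isPersuasive (hAB : A ≠ B) (hn : 2 ≤ n) :
    (lotteryMechanism (gapLottery A B)).IsPersuasive .noDisclosure (gapInstance A B) := by
  have n_ne_zero : (n : ℝ) ≠ 0 := by exact_mod_cast A.pos.ne'
  have recv_le (i : Fin n) :
      (gapInstance A B).recv i ≤ (Pi.single A (2 * n) : Fin n → ℝ) i + (1 + 1 / n) := by
    rcases eq_or_ne i A with rfl | hi
    · rw [gapInstance_recv_left hAB, Pi.single_eq_same]
      exact le_add_of_nonneg_right (by positivity)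
    · simpa [hi] using gapInstance_recv_le hi
  refine lotteryMechanism_isPersuasive (gapLottery_mem_stdSimplex A B hn) ?_
  calc 𝔼 i, (gapInstance A B).recv i
      ≤ (∑ i, ((Pi.single A (2 * n) : Fin n → ℝ) i + (1 + 1 / n))) / n := by
        rw [Fintype.expect_eq_sum_div_card, Fintype.card_fin]
        gcongr with i
        exact recv_le i
    _ = 3 + 1 / n := by
        simp only [sum_add_distrib, sum_pi_single', mem_univ, if_true, sum_const, card_univ,
          Fintype.card_fin, nsmul_eq_mul]
        field_simp [n_ne_zero]
        ring
    _ ≤ 4 := by linarith [one_div (n : ℝ) ▸ Nat.cast_inv_le_one (α := ℝ) n]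
    _ = ∑ i, gapLottery A B i * (gapInstance A B).recv i := by
        rw [sum_gapLottery_mul, gapInstance_recv_left hAB, gapInstance_recv_right]
        field_simp [n_ne_zero]
        norm_num

theorem le_of_isBenchmarkOptimum_gapInstance (hAB : A ≠ B) (hn : 2 ≤ n) {obj : Objective} {v : ℝ}
    (hv : (gapInstance A B).IsBenchmarkOptimum obj v) : 1 - 2 / n ≤ v := by
  have lottery_value := lotteryMechanism_senderValue (gapLottery_mem_stdSimplex A B hn)
    .noDisclosure (gapInstance A B) obj
  rw [sum_gapLottery_mul, gapInstance_senderPayoff_right, mul_one] at lottery_value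
  refine le_trans ?_ (hv.2 ⟨_, lotteryMechanism_gapLottery_isPersuasive hAB hn, rfl⟩)
  rw [lottery_value]
  exact le_add_of_nonneg_left
    (mul_nonneg (by positivity) (gapInstance_senderPayoff_nonneg A B obj A))

theorem senderValue_disclosure_gapInstance_le (hAB : A ≠ B) {φ : Mechanism n}
    (hφ : φ.IsPersuasive .disclosure (gapInstance A B)) (obj : Objective) :
    φ.senderValue .disclosure (gapInstance A B) obj ≤ 1 / 2 + 3 / n := by
  have one_div_nonneg : (0 : ℝ) ≤ 1 / n := by positivity
  have : Nonempty (Order n) := ⟨1⟩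
  calc φ.senderValue .disclosure (gapInstance A B) obj
      ≤ φ.expect (fun π σ =>
          payoffFrom 0 (obedient .disclosure n) (Pi.single B 1) π σ + 1 / n) :=
        φ.expect_mono (payoffFrom_le_payoffFrom_add one_div_nonneg
          (gapInstance_senderPayoff_le A B obj) 0 _)
    _ = φ.expect (payoffFrom 0 (obedient .disclosure n) (Pi.single B 1)) + 1 / n := by
        rw [φ.expect_add, φ.expect_order fun _ => 1 / (n : ℝ), Fintype.expect_const]
    _ ≤ 1 / 2 + 1 / n + 1 / n + 1 / n := by
        gcongr
        exact hφ.expect_hired_le hAB one_div_nonneg (gapInstance_recv_right A B)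
          (fun _ => one_le_gapInstance_recv) fun _ => gapInstance_recv_le
    _ = 1 / 2 + 3 / n := by ring

end GapInstance

end Persuasion

theorem mainTheorem6 (ε : ℝ) (hε : 0 < ε) :
    ∃ (n : ℕ) (_ : 0 < n) (I : Persuasion.Instance n),
      ∀ obj : Persuasion.Objective, ∃ OPT : ℝ, I.IsBenchmarkOptimum obj OPT ∧
        ∀ φ : Persuasion.Mechanism n, φ.IsPersuasive .disclosure I →
          φ.senderValue .disclosure I obj ≤ (1 / 2 + ε) * OPT := by
  obtain ⟨n, hn⟩ := exists_nat_gt (max 4 (8 / ε))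
  obtain ⟨four_lt_n, eight_div_lt_n⟩ := max_lt_iff.1 hn
  have two_le_n : 2 ≤ n := by exact_mod_cast (show (2 : ℝ) ≤ n by linarith)
  let A : Fin n := ⟨0, by omega⟩
  let B : Fin n := ⟨1, by omega⟩
  have hAB : A ≠ B := by simp [A, B]
  refine ⟨n, by omega, Persuasion.gapInstance A B, fun obj => ?_⟩
  obtain ⟨OPT, hOPT⟩ := (Persuasion.gapInstance A B).exists_isBenchmarkOptimum obj
    ⟨_, Persuasion.lotteryMechanism_gapLottery_isPersuasive hAB two_le_n⟩
  refine ⟨OPT, hOPT, fun φ hφ => ?_⟩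
  have gap : 1 / 2 + 3 / n ≤ (1 / 2 + ε) * (1 - 2 / n) := by
    rw [div_lt_iff₀ hε] at eight_div_lt_n
    field_simp
    nlinarith
  calc φ.senderValue .disclosure (Persuasion.gapInstance A B) obj
      ≤ 1 / 2 + 3 / n := Persuasion.senderValue_disclosure_gapInstance_le hAB hφ obj
    _ ≤ (1 / 2 + ε) * (1 - 2 / n) := gap
    _ ≤ (1 / 2 + ε) * OPT := by
        gcongr
        exact Persuasion.le_of_isBenchmarkOptimum_gapInstance hAB two_le_n hOPT
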